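/- Let $A_0=\mathbb{R}$ with trivial conjugation and, for $n\ge 0$, let $A_{n+1}=A_n\times A_n$ be the Cayley–Dickson algebra with conjugation $(a,b)^*=(a^*,-b)$ and multiplication $(a,b)(c,d)=(ac-d^*b,\;da+bc^*)$; thus $A_3$ is the algebra of octonions and $A_4$ that of sedenions. Let $\operatorname{Re}(x)=\tfrac12(x+x^*)$, call $x$ imaginary if $\operatorname{Re}(x)=0$, and give $A_n$ the real inner product $\langle x,y\rangle=\operatorname{Re}(xy^*)$ and the norm $\|x\|=\sqrt{\langle x,x\rangle}$. For a non-zero $v\in A_n$, let $M_v:A_n\to A_n$ be the $\mathbb{R}$-linear map $M_v(x)=\|v\|^{-2}\,v^*(vx)$. The eigenvalues of $v$ and their multiplicities are the real eigenvalues of $M_v$ and the real dimensions of the corresponding eigenspaces. Let $a$ and $b$ be linearly independent imaginary elements of $A_3$, and let $\theta\in[0,\pi]$ be the angle between them. Then the eigenvalues of $(a,b)\in A_4$ are exactly $$1,\qquad 1+\frac{2\|a\|\,\|b\|\sin\theta}{\|a\|^2+\|b\|^2},\qquad 1-\frac{2\|a\|\,\|b\|\sin\theta}{\|a\|^2+\|b\|^2},$$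 with multiplicities $8$, $4$ and $4$ respectively. -/

import Mathlib

noncomputable section

/-- The underlying type of the real Cayley-Dickson algebra `A n`: `A 0 = ℝ` and
`A (n + 1) = A n × A n`. So `A 3` is the octonions and `A 4` is the sedenions. -/
def CayleyDickson : ℕ → Type
  | 0 => ℝ
  | n + 1 => CayleyDickson n × CayleyDickson n

namespace CayleyDickson

/-- The additive structure is componentwise. -/
@[reducible]
def addCommGroupAux : (n : ℕ) → AddCommGroup (CayleyDickson n)
  | 0 => inferInstanceAs (AddCommGroup ℝ)
  | n + 1 =>
    letI := addCommGroupAux n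
    inferInstanceAs (AddCommGroup (CayleyDickson n × CayleyDickson n))

instance instAddCommGroup (n : ℕ) : AddCommGroup (CayleyDickson n) := addCommGroupAux n

/-- Real scalars act componentwise. -/
@[reducible]
def moduleAux : (n : ℕ) → Module ℝ (CayleyDickson n)
  | 0 => inferInstanceAs (Module ℝ ℝ)
  | n + 1 =>
    letI := moduleAux n
    inferInstanceAs (Module ℝ (CayleyDickson n × CayleyDickson n))

instance instModule (n : ℕ) : Module ℝ (CayleyDickson n) := moduleAux n

/-- The element `(a, b)` of `A (n + 1)`, for `a` and `b` in `A n`. -/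
def pair {n : ℕ} (a b : CayleyDickson n) : CayleyDickson (n + 1) := (a, b)

/-- Conjugation: the identity on `A 0 = ℝ`, and `(a, b)* = (a*, -b)`. -/
def conj : (n : ℕ) → CayleyDickson n → CayleyDickson n
  | 0, x => x
  | n + 1, x => pair (conj n x.1) (-x.2)

/-- Multiplication: that of `ℝ` on `A 0`, and `(a, b)(c, d) = (ac - d*b, da + bc*)`. -/
def mul : (n : ℕ) → CayleyDickson n → CayleyDickson n → CayleyDickson n
  | 0, x, y => HMul.hMul (α := ℝ) (β := ℝ) (γ := ℝ) x y
  | n + 1, x, y =>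
    pair (mul n x.1 y.1 - mul n (conj n y.2) x.2) (mul n y.2 x.1 + mul n x.2 (conj n y.1))

/-- The unit: `1` on `A 0 = ℝ`, and `(1, 0)` on `A (n + 1)`. -/
def one : (n : ℕ) → CayleyDickson n
  | 0 => (1 : ℝ)
  | n + 1 => pair (one n) 0

instance instMul (n : ℕ) : Mul (CayleyDickson n) := ⟨mul n⟩
instance instOne (n : ℕ) : One (CayleyDickson n) := ⟨one n⟩
instance instStar (n : ℕ) : Star (CayleyDickson n) := ⟨conj n⟩

section Equations

variable {n : ℕ}

theorem pair_surj (x : CayleyDickson (n + 1)) : ∃ a b : CayleyDickson n, x = pair a b :=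
  ⟨x.1, x.2, rfl⟩

theorem pair_add (a b c d : CayleyDickson n) : pair a b + pair c d = pair (a + c) (b + d) := rfl

theorem smul_pair (r : ℝ) (a b : CayleyDickson n) : r • pair a b = pair (r • a) (r • b) := rfl

theorem zero_eq_pair : (0 : CayleyDickson (n + 1)) = pair 0 0 := rfl

theorem one_eq_pair : (1 : CayleyDickson (n + 1)) = pair 1 0 := rfl

theorem star_pair (a b : CayleyDickson n) : star (pair a b) = pair (star a) (-b) := rfl

theorem pair_mul (a b c d : CayleyDickson n) :
    pair a b * pair c d = pair (a * c - star d * b) (d * a + b * star c) := rfl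

theorem star_add' (x y : CayleyDickson n) : star (x + y) = star x + star y := by
  induction n with
  | zero => rfl
  | succ n ih =>
    obtain ⟨a, b, rfl⟩ := pair_surj x
    obtain ⟨c, d, rfl⟩ := pair_surj y
    simp only [pair_add, star_pair, ih, neg_add]

theorem star_smul' (r : ℝ) (x : CayleyDickson n) : star (r • x) = r • star x := by
  induction n with
  | zero => rfl
  | succ n ih =>
    obtain ⟨a, b, rfl⟩ := pair_surj x
    simp only [smul_pair, star_pair, ih, smul_neg]

theorem star_zero' : star (0 : CayleyDickson n) = 0 := by
  have h := star_smul' (0 : ℝ) (0 : CayleyDickson n)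
  simpa using h

theorem star_one' : star (1 : CayleyDickson n) = 1 := by
  induction n with
  | zero => rfl
  | succ n ih => simp only [one_eq_pair, star_pair, ih, neg_zero]

theorem distrib_aux (x y z : CayleyDickson n) :
    x * (y + z) = x * y + x * z ∧ (x + y) * z = x * z + y * z := by
  induction n with
  | zero => exact ⟨@mul_add ℝ _ _ _ x y z, @add_mul ℝ _ _ _ x y z⟩
  | succ n ih =>
    obtain ⟨a, b, rfl⟩ := pair_surj x
    obtain ⟨c, d, rfl⟩ := pair_surj y
    obtain ⟨e, f, rfl⟩ := pair_surj z
    have h1 := fun u v w : CayleyDickson n => (ih u v w).1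
    have h2 := fun u v w : CayleyDickson n => (ih u v w).2
    constructor <;>
    · simp only [pair_add, pair_mul, star_add', h1, h2]
      congr 1 <;> abel

theorem smul_aux (r : ℝ) (x y : CayleyDickson n) :
    (r • x) * y = r • (x * y) ∧ x * (r • y) = r • (x * y) := by
  induction n with
  | zero => exact ⟨@mul_assoc ℝ _ r x y, @mul_left_comm ℝ _ x r y⟩
  | succ n ih =>
    obtain ⟨a, b, rfl⟩ := pair_surj x
    obtain ⟨c, d, rfl⟩ := pair_surj y
    have h1 := fun u v : CayleyDickson n => (ih u v).1
    have h2 := fun u v : CayleyDickson n => (ih u v).2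
    constructor <;>
    · simp only [smul_pair, pair_mul, star_smul', h1, h2, smul_sub, smul_add]

theorem zero_mul_aux (x : CayleyDickson n) : 0 * x = 0 := by
  simpa using (smul_aux (0 : ℝ) 0 x).1

theorem mul_zero_aux (x : CayleyDickson n) : x * 0 = 0 := by
  simpa using (smul_aux (0 : ℝ) x 0).2

theorem one_mul_aux (x : CayleyDickson n) : 1 * x = x ∧ x * 1 = x := by
  induction n with
  | zero => exact ⟨@one_mul ℝ _ x, @mul_one ℝ _ x⟩
  | succ n ih =>
    obtain ⟨a, b, rfl⟩ := pair_surj x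
    simp only [one_eq_pair, pair_mul, star_one', star_zero', zero_mul_aux, mul_zero_aux,
      fun u : CayleyDickson n => (ih u).1, fun u : CayleyDickson n => (ih u).2, sub_zero, add_zero,
      zero_add, and_self]

end Equations

instance instNonAssocRing (n : ℕ) : NonAssocRing (CayleyDickson n) where
  __ := instAddCommGroup n
  left_distrib x y z := (distrib_aux x y z).1
  right_distrib x y z := (distrib_aux x y z).2
  zero_mul := zero_mul_aux
  mul_zero := mul_zero_aux
  one_mul x := (one_mul_aux x).1
  mul_one x := (one_mul_aux x).2

instance instIsScalarTower (n : ℕ) : IsScalarTower ℝ (CayleyDickson n) (CayleyDickson n) :=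
  ⟨fun r x y => (smul_aux r x y).1⟩

instance instSMulCommClass (n : ℕ) : SMulCommClass ℝ (CayleyDickson n) (CayleyDickson n) :=
  ⟨fun r x y => (smul_aux r x y).2.symm⟩

/-- The real part `Re(x) = (x + x*) / 2`, as an element of `A n`. -/
def rePart {n : ℕ} (x : CayleyDickson n) : CayleyDickson n := (1 / 2 : ℝ) • (x + star x)

/-- `x` is imaginary if its real part vanishes. -/
def IsImaginary {n : ℕ} (x : CayleyDickson n) : Prop := rePart x = 0

/-- The real number `r` with `Re(x) = r • 1` (see `rePart_eq`). -/
def re : (n : ℕ) → CayleyDickson n → ℝ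
  | 0, x => x
  | n + 1, x => re n x.1

theorem rePart_eq {n : ℕ} (x : CayleyDickson n) : rePart x = re n x • (1 : CayleyDickson n) := by
  induction n with
  | zero =>
    have h : ∀ u : ℝ, (1 / 2 : ℝ) * (u + u) = u * 1 := fun u => by ring
    exact h x
  | succ n ih =>
    obtain ⟨a, b, rfl⟩ := pair_surj x
    have h := ih a
    rw [rePart] at h ⊢
    rw [star_pair, pair_add, smul_pair, h, one_eq_pair, smul_pair, add_neg_cancel, smul_zero,
      smul_zero]
    rfl

theorem re_add {n : ℕ} (x y : CayleyDickson n) : re n (x + y) = re n x + re n y := by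
  induction n with
  | zero => rfl
  | succ n ih => exact ih x.1 y.1

theorem re_smul {n : ℕ} (r : ℝ) (x : CayleyDickson n) : re n (r • x) = r * re n x := by
  induction n with
  | zero => rfl
  | succ n ih => exact ih x.1

/-- The real inner product `⟨a, b⟩ = Re(a b*)`. -/
instance instInner (n : ℕ) : Inner ℝ (CayleyDickson n) := ⟨fun a b => re n (a * star b)⟩

theorem inner_def {n : ℕ} (a b : CayleyDickson n) : inner ℝ a b = re n (a * star b) := rfl

theorem inner_aux {n : ℕ} (a b : CayleyDickson n) :
    re n (star a * b) = re n (a * star b) ∧ re n (b * star a) = re n (a * star b) := by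
  induction n with
  | zero => exact ⟨rfl, @mul_comm ℝ _ b a⟩
  | succ n ih =>
    obtain ⟨a, a', rfl⟩ := pair_surj a
    obtain ⟨b, b', rfl⟩ := pair_surj b
    have e : ∀ u v : CayleyDickson n, re (n + 1) (pair u v) = re n u := fun _ _ => rfl
    have s : ∀ u : CayleyDickson n, star (-u) = -star u := fun u => by
      simpa using star_smul' (-1 : ℝ) u
    have := ih a b
    have h1 := ih a' b'
    have h2 := ih b' a'
    simp only [star_pair, pair_mul, e, s, mul_neg, neg_mul, sub_neg_eq_add, re_add]
    exact ⟨by rw [this.1], by rw [this.2, h1.1, h2.1, h1.2]⟩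

/-- The inner product on `A (n + 1) = A n × A n` is the sum of those of the components. -/
theorem inner_pair {n : ℕ} (a b c d : CayleyDickson n) :
    inner ℝ (pair a b) (pair c d) = inner ℝ a c + inner ℝ b d := by
  have e : ∀ u v : CayleyDickson n, re (n + 1) (pair u v) = re n u := fun _ _ => rfl
  have s : star (-d) = -star d := by simpa using star_smul' (-1 : ℝ) d
  simp only [inner_def, star_pair, pair_mul, e, s, neg_mul, sub_neg_eq_add, re_add]
  rw [(inner_aux d b).1, (inner_aux b d).2]

theorem inner_self_aux {n : ℕ} (a : CayleyDickson n) :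
    0 ≤ inner ℝ a a ∧ (inner ℝ a a = 0 → a = 0) := by
  induction n with
  | zero =>
    have h : ∀ u : ℝ, 0 ≤ u * u ∧ (u * u = 0 → u = 0) :=
      fun u => ⟨mul_self_nonneg u, mul_self_eq_zero.1⟩
    exact h a
  | succ n ih =>
    obtain ⟨a, b, rfl⟩ := pair_surj a
    rw [inner_pair]
    refine ⟨add_nonneg (ih a).1 (ih b).1, fun h => ?_⟩
    have h1 := (ih a).1
    have h2 := (ih b).1
    rw [(ih a).2 (by linarith), (ih b).2 (by linarith)]
    rfl

/-- `A n` is a positive-definite real inner product space under `Re(a b*)`. -/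
@[reducible]
def innerCore (n : ℕ) : InnerProductSpace.Core ℝ (CayleyDickson n) where
  inner := inner ℝ
  conj_inner_symm x y := (inner_aux x y).2
  re_inner_nonneg x := (inner_self_aux x).1
  add_left x y z := by simp only [inner_def, add_mul, re_add]
  smul_left x y r := by simp only [inner_def, (smul_aux r _ _).1, re_smul]; rfl
  definite x := (inner_self_aux x).2

/-- The norm is `‖a‖ = √⟨a, a⟩`. -/
instance instNormedAddCommGroup (n : ℕ) : NormedAddCommGroup (CayleyDickson n) :=
  (innerCore n).toNormedAddCommGroup

instance instInnerProductSpace (n : ℕ) : InnerProductSpace ℝ (CayleyDickson n) :=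
  InnerProductSpace.ofCore (innerCore n).toCore

/-- The operator `M_a = ‖a‖⁻² L_{a*} L_a` on `A n`, where `L_a` is left multiplication by `a`;
the eigenvalues of `a` are those of `M_a`. -/
def M {n : ℕ} (a : CayleyDickson n) : Module.End ℝ (CayleyDickson n) :=
  (1 / ‖a‖ ^ 2) • (LinearMap.mulLeft ℝ (star a) ∘ₗ LinearMap.mulLeft ℝ a)

end CayleyDickson

end

/-!
Let `T x = [a, b, x]` be the associator with `a` and `b`, and let `N = ‖a‖² + ‖b‖²`. On `A₃ × A₃`
the operator `M` of `(a, b)` is `id + N⁻¹ S`, where `S (x, y) = (-T y, T x)`, so the eigenvalues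
of `M` and their multiplicities are read off those of `S`.

In an alternative algebra `2T = W - V` with `W = L_[a,b]` and `V = [L_a, L_b]`. Both `W²` and `V²`
equal `-s²`, where `s = 2‖a‖‖b‖ sin θ`. Since `[a, b]` anticommutes with `a` and with `b`, the maps
`W` and `V` commute, and hence `T³ = -s² T`. It follows that `S³ = s² S`, and the only possible
eigenvalues of `S` are `0` and `±s`.

For the multiplicities, choose `c ≠ 0` orthogonal to `1`, `a`, `b` and `[a, b]`, which is possible
in dimension `8`. Left multiplication by `c` anticommutes with `W` and commutes with `V`, so it
exchanges the two eigenspaces of the operator `WV`, one of which is `ker T`; hence `ker T` has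
dimension `4` and `ker S` has dimension `8`. The map `(x, y) ↦ (x, -y)` anticommutes with `S`, so
the eigenspaces of `S` for `s` and `-s` share the remaining `8` dimensions equally.
-/

section Eigenspaces

open Module Polynomial

variable {F V : Type*} [Field F] [AddCommGroup V] [Module F V]

theorem finrank_submodule_prod {W : Type*} [AddCommGroup W] [Module F W] [FiniteDimensional F V]
    [FiniteDimensional F W] (p : Submodule F V) (q : Submodule F W) :
    finrank F (p.prod q) = finrank F p + finrank F q := by
  have hinj : Function.Injective (p.subtype.prodMap q.subtype) :=
    p.subtype_injective.prodMap q.subtype_injective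
  rw [← finrank_prod, ← LinearMap.finrank_range_of_inj hinj, LinearMap.range_prodMap,
    p.range_subtype, q.range_subtype]

theorem hasEigenvalue_iff_finrank_ne_zero [FiniteDimensional F V] {f : End F V} {μ : F} :
    f.HasEigenvalue μ ↔ finrank F (f.eigenspace μ) ≠ 0 :=
  Submodule.finrank_eq_zero.not.symm

theorem finrank_ker_aeval_mul_of_isCoprime [FiniteDimensional F V] (f : End F V) {p q : F[X]}
    (hpq : IsCoprime p q) :
    finrank F (LinearMap.ker (aeval f (p * q))) =
      finrank F (LinearMap.ker (aeval f p)) + finrank F (LinearMap.ker (aeval f q)) := by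
  rw [← sup_ker_aeval_eq_ker_aeval_mul_of_coprime f hpq,
    ← Submodule.finrank_sup_add_finrank_inf_eq,
    (disjoint_ker_aeval_of_isCoprime f hpq).eq_bot, finrank_bot, add_zero]

theorem ker_aeval_X_sub_C (f : End F V) (μ : F) :
    LinearMap.ker (aeval f (X - C μ)) = f.eigenspace μ := by
  ext x
  simp [sub_eq_zero]

theorem finrank_eigenspace_le_neg_of_semiconjBy [FiniteDimensional F V] {f g : End F V}
    (hg : Function.Injective g) (hgf : SemiconjBy g f (-f)) (μ : F) :
    finrank F (f.eigenspace μ) ≤ finrank F (f.eigenspace (-μ)) := by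
  rw [(Submodule.equivMapOfInjective g hg _).finrank_eq]
  apply Submodule.finrank_mono
  rintro _ ⟨x, hx, rfl⟩
  have hgfx : g (f x) = -f (g x) := LinearMap.congr_fun hgf.eq x
  rw [End.mem_eigenspace_iff.1 hx, map_smul] at hgfx
  rw [End.mem_eigenspace_iff, neg_smul, hgfx, neg_neg]

theorem finrank_eigenspace_neg_of_semiconjBy [FiniteDimensional F V] {f g : End F V}
    (hg : Function.Injective g) (hgf : SemiconjBy g f (-f)) (μ : F) :
    finrank F (f.eigenspace (-μ)) = finrank F (f.eigenspace μ) :=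
  le_antisymm
    ((finrank_eigenspace_le_neg_of_semiconjBy hg hgf (-μ)).trans_eq (by rw [neg_neg]))
    (finrank_eigenspace_le_neg_of_semiconjBy hg hgf μ)

theorem finrank_ker_aeval_sq_sub_sq_of_semiconjBy [NeZero (2 : F)] [FiniteDimensional F V]
    {f g : End F V} {s : F} (hs : s ≠ 0) (hg : Function.Injective g)
    (hgf : SemiconjBy g f (-f)) :
    finrank F (LinearMap.ker (aeval f (X ^ 2 - C (s ^ 2)))) =
      2 * finrank F (f.eigenspace s) := by
  have hcoprime : IsCoprime (X - C s) (X - C (-s)) :=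
    isCoprime_X_sub_C_of_isUnit_sub (by simpa [← two_mul] using ⟨two_ne_zero, hs⟩)
  have hfactor : (X ^ 2 - C (s ^ 2) : F[X]) = (X - C s) * (X - C (-s)) := by
    simp only [C_pow, C_neg]
    ring
  rw [hfactor, finrank_ker_aeval_mul_of_isCoprime f hcoprime, ker_aeval_X_sub_C,
    ker_aeval_X_sub_C, finrank_eigenspace_neg_of_semiconjBy hg hgf, two_mul]

theorem two_mul_finrank_eigenspace_of_sq_eq [NeZero (2 : F)] [FiniteDimensional F V]
    {f g : End F V} {s : F} (hs : s ≠ 0) (hf : f ^ 2 = s ^ 2 • 1) (hg : Function.Injective g)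
    (hgf : SemiconjBy g f (-f)) :
    2 * finrank F (f.eigenspace s) = finrank F V := by
  have hzero : aeval f (X ^ 2 - C (s ^ 2)) = 0 := by
    rw [map_sub, aeval_X_pow, aeval_C, hf, Algebra.algebraMap_eq_smul_one, sub_self]
  rw [← finrank_ker_aeval_sq_sub_sq_of_semiconjBy hs hg hgf, hzero, LinearMap.ker_zero,
    finrank_top]

theorem finrank_ker_add_two_mul_finrank_eigenspace_of_pow_three_eq [NeZero (2 : F)]
    [FiniteDimensional F V] {f g : End F V} {s : F} (hs : s ≠ 0) (hf : f ^ 3 = s ^ 2 • f)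
    (hg : Function.Injective g) (hgf : SemiconjBy g f (-f)) :
    finrank F (LinearMap.ker f) + 2 * finrank F (f.eigenspace s) = finrank F V := by
  have hcoprime : IsCoprime (X : F[X]) (X ^ 2 - C (s ^ 2)) :=
    have hC : C (s ^ 2)⁻¹ * C (s ^ 2) = 1 := by
      rw [← C_mul, inv_mul_cancel₀ (pow_ne_zero 2 hs), C_1]
    ⟨C (s ^ 2)⁻¹ * X, -C (s ^ 2)⁻¹, by linear_combination hC⟩
  have hzero : aeval f (X * (X ^ 2 - C (s ^ 2))) = 0 := by
    rw [mul_sub, ← pow_succ', map_sub, aeval_X_pow, map_mul, aeval_X, aeval_C, hf,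
      Algebra.algebraMap_eq_smul_one, mul_smul_comm, mul_one, sub_self]
  have hker := finrank_ker_aeval_mul_of_isCoprime f hcoprime
  rwa [hzero, LinearMap.ker_zero, finrank_top, aeval_X,
    finrank_ker_aeval_sq_sub_sq_of_semiconjBy hs hg hgf, eq_comm] at hker

theorem eq_zero_or_eq_or_eq_neg_of_pow_three_eq {f : End F V} {s μ : F}
    (hf : f ^ 3 = s ^ 2 • f) (hμ : f.HasEigenvalue μ) : μ = 0 ∨ μ = s ∨ μ = -s := by
  obtain ⟨v, hv⟩ := hμ.exists_hasEigenvector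
  have hcube : μ ^ 3 • v = (s ^ 2 * μ) • v := by
    rw [← hv.pow_apply, hf, LinearMap.smul_apply, hv.apply_eq_smul, smul_smul]
  have hroot : μ * (μ ^ 2 - s ^ 2) = 0 := by
    linear_combination smul_left_injective F hv.2 hcube
  exact (mul_eq_zero.1 hroot).imp_right fun h => sq_eq_sq_iff_eq_or_eq_neg.1 (sub_eq_zero.1 h)

end Eigenspaces

section SkewBlock

open Module

variable {R V : Type*} [CommRing R] [AddCommGroup V] [Module R V]

/-- The endomorphism `(x, y) ↦ (-T y, T x)` of `V × V`, with block matrix `!![0, -T; T, 0]`. The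
operator `M` of a pair of imaginary elements is a perturbation of the identity of this shape. -/
def skewBlock (T : End R V) : End R (V × V) :=
  (-(T ∘ₗ LinearMap.snd R V V)).prod (T ∘ₗ LinearMap.fst R V V)

theorem skewBlock_apply (T : End R V) (z : V × V) : skewBlock T z = (-T z.2, T z.1) := rfl

theorem skewBlock_pow_three {T : End R V} {r : R} (hT : T ^ 3 = -(r • T)) :
    skewBlock T ^ 3 = r • skewBlock T := by
  have hT' : ∀ x, T (T (T x)) = -(r • T x) := LinearMap.congr_fun hT
  refine LinearMap.ext fun z => ?_
  simp [pow_succ, skewBlock_apply, hT']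

theorem ker_skewBlock (T : End R V) :
    LinearMap.ker (skewBlock T) = (LinearMap.ker T).prod (LinearMap.ker T) := by
  ext z
  simp [skewBlock_apply, and_comm]

theorem semiconjBy_skewBlock_neg (T : End R V) :
    SemiconjBy (LinearMap.prodMap 1 (-1)) (skewBlock T) (-skewBlock T) := by
  ext z <;> simp [skewBlock_apply]

theorem finrank_ker_add_finrank_eigenspace_skewBlock {F V : Type*} [Field F] [NeZero (2 : F)]
    [AddCommGroup V] [Module F V] [FiniteDimensional F V] {T : End F V} {s : F} (hs : s ≠ 0)
    (hT : T ^ 3 = -(s ^ 2 • T)) :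
    finrank F (LinearMap.ker T) + finrank F ((skewBlock T).eigenspace s) = finrank F V := by
  have hinj : Function.Injective (LinearMap.prodMap (1 : End F V) (-1 : End F V)) :=
    Function.injective_id.prodMap neg_injective
  have h := finrank_ker_add_two_mul_finrank_eigenspace_of_pow_three_eq hs
    (skewBlock_pow_three hT) hinj (semiconjBy_skewBlock_neg T)
  rw [ker_skewBlock, finrank_submodule_prod, finrank_prod] at h
  omega

end SkewBlock

section CommutingSquareRoots

open Module

theorem sub_pow_three_of_commute {F S : Type*} [CommRing F] [Ring S] [Algebra F S] {U V : S}
    {r : F} (hU : U ^ 2 = -(r • 1)) (hV : V ^ 2 = -(r • 1)) (hUV : Commute U V) :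
    (U - V) ^ 3 = -((4 * r) • (U - V)) := by
  have hexpand : (U - V) ^ 3 = U ^ 2 * U - 3 • (U ^ 2 * V) + 3 • (V ^ 2 * U) - V ^ 2 * V := by
    simp only [pow_succ, pow_zero, one_mul, sub_mul, mul_sub, mul_assoc, hUV.eq, ← hUV.left_comm]
    abel
  rw [hexpand, hU, hV]
  simp only [neg_mul, smul_mul_assoc, one_mul]
  module

theorem lie_pow_two_of_anticommutator {F S : Type*} [CommRing F] [Ring S] [Algebra F S] {A B : S}
    {α β τ : F} (hA : A ^ 2 = -(α • 1)) (hB : B ^ 2 = -(β • 1))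
    (hAB : A * B + B * A = -((2 * τ) • 1)) :
    ⁅A, B⁆ ^ 2 = -((4 * (α * β - τ ^ 2)) • 1) := by
  calc ⁅A, B⁆ ^ 2 = (A * B + B * A) ^ 2 - 2 * (A * B ^ 2 * A + B * A ^ 2 * B) := by
        rw [Ring.lie_def]
        noncomm_ring
    _ = -((4 * (α * β - τ ^ 2)) • 1) := by
        rw [hAB, hA, hB]
        simp only [mul_neg, neg_mul, mul_smul_comm, smul_mul_assoc, mul_one, ← sq, hA, hB,
          neg_sq, smul_pow, one_pow, two_mul]
        module

theorem commute_lie_of_semiconjBy_neg {S : Type*} [Ring S] {A B C : S}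
    (hA : SemiconjBy C A (-A)) (hB : SemiconjBy C B (-B)) : Commute C ⁅A, B⁆ := by
  have hAB := (hA.mul_right hB).sub_right (hB.mul_right hA)
  rwa [neg_mul_neg, neg_mul_neg] at hAB

theorem injective_of_pow_two_eq_neg_smul {F V : Type*} [Field F] [AddCommGroup V] [Module F V]
    {f : End F V} {r : F} (hr : r ≠ 0) (hf : f ^ 2 = -(r • 1)) : Function.Injective f := by
  have hff : Function.Injective ⇑(f ^ 2 : End F V) := by
    rw [hf]
    exact neg_injective.comp (smul_right_injective V hr)
  rw [sq] at hff
  exact Function.Injective.of_comp (f := f) hff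

theorem two_mul_finrank_ker_sub_of_commute {F V : Type*} [Field F] [NeZero (2 : F)]
    [AddCommGroup V] [Module F V] [FiniteDimensional F V] {f g h : End F V} {r : F} (hr : r ≠ 0)
    (hf : f ^ 2 = -(r • 1)) (hg : g ^ 2 = -(r • 1)) (hfg : Commute f g)
    (hh : Function.Injective h) (hhf : SemiconjBy h f (-f)) (hhg : Commute h g) :
    2 * finrank F (LinearMap.ker (f - g)) = finrank F V := by
  have hsq : (f * g) ^ 2 = (-r) ^ 2 • 1 := by
    rw [hfg.mul_pow, hf, hg]
    simp [smul_smul, sq]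
  have hanti : SemiconjBy h (f * g) (-(f * g)) := by
    rw [← neg_mul]
    exact hhf.mul_right hhg
  have hker : LinearMap.ker (f - g) = (f * g).eigenspace (-r) := by
    ext x
    have hfx : f (f x) = -(r • x) := LinearMap.congr_fun (sq f ▸ hf) x
    rw [LinearMap.mem_ker, LinearMap.sub_apply, sub_eq_zero, End.mem_eigenspace_iff, neg_smul,
      ← hfx, Module.End.mul_apply, (injective_of_pow_two_eq_neg_smul hr hf).eq_iff, eq_comm]
  rw [hker, two_mul_finrank_eigenspace_of_sq_eq (neg_ne_zero.2 hr) hsq hh hanti]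

end CommutingSquareRoots

section Alternative

/-- A not necessarily associative ring is alternative if any two of its elements generate an
associative subring; this is encoded by the two identities `(xx)y = x(xy)` and `(yx)x = y(xx)`. -/
class IsAlternative (A : Type*) [NonUnitalNonAssocRing A] : Prop where
  mul_self_mul (x y : A) : x * x * y = x * (x * y)
  mul_mul_self (x y : A) : y * x * x = y * (x * x)

variable {A : Type*} [NonUnitalNonAssocRing A] [IsAlternative A]

theorem associator_self_left (x y : A) : associator x x y = 0 :=
  sub_eq_zero.2 (IsAlternative.mul_self_mul x y)

theorem associator_self_right (x y : A) : associator y x x = 0 :=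
  sub_eq_zero.2 (IsAlternative.mul_mul_self x y)

theorem associator_swap_left (x y z : A) : associator x y z = -associator y x z := by
  have h := associator_self_left (x + y) z
  have hx := associator_self_left x z
  have hy := associator_self_left y z
  simp only [← AddMonoidHom.associator_apply, map_add, AddMonoidHom.add_apply] at h hx hy ⊢
  rw [hx, hy, zero_add, add_zero] at h
  exact eq_neg_of_add_eq_zero_right h

theorem associator_swap_right (x y z : A) : associator x y z = -associator x z y := by
  have h := associator_self_right (y + z) x
  have hy := associator_self_right y x
  have hz := associator_self_right z x
  simp only [← AddMonoidHom.associator_apply, map_add, AddMonoidHom.add_apply] at h hy hz ⊢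
  rw [hy, hz, zero_add, add_zero] at h
  exact eq_neg_of_add_eq_zero_right h

theorem associator_self_outer (x y : A) : associator x y x = 0 := by
  rw [associator_swap_right, associator_self_left, neg_zero]

theorem associator_rotate (x y z : A) : associator x y z = associator y z x := by
  rw [associator_swap_left, associator_swap_right, neg_neg]

theorem associator_mul_self_self (x y : A) : associator x (x * y) y = 0 := by
  have h := associator_cocycle x x y y
  simpa only [associator_self_left, associator_self_right, mul_zero, zero_mul, sub_zero, zero_add,
    add_zero] using h

theorem associator_lie_right (x y : A) : associator x y ⁅x, y⁆ = 0 := by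
  have hxy : associator x y (x * y) = 0 := by
    rw [associator_swap_right, associator_mul_self_self, neg_zero]
  have hyx : associator x y (y * x) = 0 := by
    rw [associator_rotate, associator_mul_self_self]
  rw [Ring.lie_def, ← AddMonoidHom.associator_apply, map_sub, AddMonoidHom.associator_apply,
    AddMonoidHom.associator_apply, hxy, hyx, sub_zero]

theorem mul_mul_add_mul_mul (x y z : A) : x * (y * z) + y * (x * z) = (x * y + y * x) * z := by
  have h := associator_swap_left x y z
  rw [associator_apply, associator_apply, neg_sub, sub_eq_sub_iff_add_eq_add] at h
  rw [add_mul, add_comm, ← h, add_comm]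

theorem mul_lie_add_lie_mul (x y : A) : x * ⁅x, y⁆ + ⁅x, y⁆ * x = ⁅x * x, y⁆ := by
  have h := associator_self_outer x y
  rw [associator_apply, sub_eq_zero] at h
  rw [Ring.lie_def, Ring.lie_def, mul_sub, sub_mul, IsAlternative.mul_self_mul,
    IsAlternative.mul_mul_self, h]
  abel

end Alternative

section LeftMultiplication

open Module

variable {F A : Type*} [CommRing F] [NonUnitalNonAssocRing A] [Module F A] [SMulCommClass F A A]

variable (F) in
/-- The linear map `x ↦ [a, b, x]`, where `[a, b, x] = (ab)x - a(bx)` is the associator. -/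
def associatorLeft (a b : A) : End F A :=
  LinearMap.mulLeft F (a * b) - LinearMap.mulLeft F a * LinearMap.mulLeft F b

theorem associatorLeft_apply (a b x : A) : associatorLeft F a b x = associator a b x := rfl

theorem mulLeft_neg_smul_one {A : Type*} [NonAssocRing A] [Module F A]
    [IsScalarTower F A A] [SMulCommClass F A A] (r : F) :
    LinearMap.mulLeft F (-(r • (1 : A))) = -(r • (1 : End F A)) :=
  LinearMap.ext fun x => by
    rw [LinearMap.mulLeft_apply, neg_mul, smul_one_mul]
    rfl

variable [IsAlternative A]

theorem mulLeft_pow_two (a : A) : LinearMap.mulLeft F a ^ 2 = LinearMap.mulLeft F (a * a) :=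
  LinearMap.ext fun x => (IsAlternative.mul_self_mul a x).symm

theorem mulLeft_mul_add_mulLeft_mul (a b : A) :
    LinearMap.mulLeft F a * LinearMap.mulLeft F b + LinearMap.mulLeft F b * LinearMap.mulLeft F a =
      LinearMap.mulLeft F (a * b + b * a) :=
  LinearMap.ext fun x => mul_mul_add_mul_mul a b x

theorem semiconjBy_mulLeft_neg {a b : A} (h : a * b + b * a = 0) :
    SemiconjBy (LinearMap.mulLeft F a) (LinearMap.mulLeft F b) (-LinearMap.mulLeft F b) := by
  rw [SemiconjBy, neg_mul, eq_neg_iff_add_eq_zero, mulLeft_mul_add_mulLeft_mul, h,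
    LinearMap.mulLeft_zero_eq_zero]

theorem two_smul_associatorLeft (a b : A) :
    (2 : F) • associatorLeft F a b =
      LinearMap.mulLeft F ⁅a, b⁆ - ⁅LinearMap.mulLeft F a, LinearMap.mulLeft F b⁆ := by
  ext x
  have h : associator a b x + associator a b x = associator a b x - associator b a x := by
    rw [sub_eq_add_neg, ← associator_swap_left]
  rw [LinearMap.smul_apply, associatorLeft_apply, two_smul, h]
  simp only [LinearMap.sub_apply, LinearMap.mulLeft_apply, Module.End.mul_apply, Ring.lie_def,
    sub_mul, associator_apply]
  abel

end LeftMultiplication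

section InnerProduct

open Module InnerProductGeometry

variable {E : Type*} [NormedAddCommGroup E] [InnerProductSpace ℝ E]

theorem exists_ne_zero_forall_inner_eq_zero [FiniteDimensional ℝ E] {ι : Type*} [Fintype ι]
    (v : ι → E) (h : Fintype.card ι < finrank ℝ E) : ∃ c : E, c ≠ 0 ∧ ∀ i, inner ℝ (v i) c = 0 := by
  have hspan : Submodule.span ℝ (Set.range v) ≠ ⊤ := fun htop => by
    have hle := finrank_range_le_card (R := ℝ) v
    rw [Set.finrank, htop, finrank_top] at hle
    exact hle.not_gt h
  obtain ⟨c, hc, hc0⟩ :=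
    Submodule.exists_mem_ne_zero_of_ne_bot (mt Submodule.orthogonal_eq_bot_iff.1 hspan)
  exact ⟨c, hc0, fun i => hc _ (Submodule.subset_span (Set.mem_range_self i))⟩

theorem sin_angle_ne_zero {a b : E} (hab : LinearIndependent ℝ ![a, b]) :
    Real.sin (angle a b) ≠ 0 := fun h => by
  rw [sin_eq_zero_iff_angle_eq_zero_or_angle_eq_pi, angle_eq_zero_iff, angle_eq_pi_iff] at h
  obtain ⟨r, hr⟩ : ∃ r : ℝ, b = r • a := by
    rcases h with ⟨_, r, _, hr⟩ | ⟨_, r, _, hr⟩ <;> exact ⟨r, hr⟩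
  exact (LinearIndependent.pair_iff' (hab.ne_zero 0)).1 hab r hr.symm

theorem two_mul_norm_mul_norm_mul_sin_angle_ne_zero {a b : E}
    (hab : LinearIndependent ℝ ![a, b]) : 2 * ‖a‖ * ‖b‖ * Real.sin (angle a b) ≠ 0 := by
  have ha : ‖a‖ ≠ 0 := norm_ne_zero_iff.2 (hab.ne_zero 0)
  have hb : ‖b‖ ≠ 0 := norm_ne_zero_iff.2 (hab.ne_zero 1)
  exact mul_ne_zero (mul_ne_zero (mul_ne_zero two_ne_zero ha) hb) (sin_angle_ne_zero hab)

theorem two_mul_norm_mul_norm_mul_sin_angle_sq (a b : E) :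
    (2 * ‖a‖ * ‖b‖ * Real.sin (angle a b)) ^ 2 =
      4 * (‖a‖ ^ 2 * ‖b‖ ^ 2 - inner ℝ a b ^ 2) := by
  rw [← cos_angle_mul_norm_mul_norm a b]
  linear_combination (4 * ‖a‖ ^ 2 * ‖b‖ ^ 2) * Real.sin_sq_add_cos_sq (angle a b)

end InnerProduct

namespace CayleyDickson

variable {n : ℕ}

section Star

theorem star_star' (x : CayleyDickson n) : star (star x) = x := by
  induction n with
  | zero => rfl
  | succ n ih =>
    obtain ⟨a, b, rfl⟩ := pair_surj x
    simp only [star_pair, ih, neg_neg]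

theorem star_mul' (x y : CayleyDickson n) : star (x * y) = star y * star x := by
  induction n with
  | zero => exact @mul_comm ℝ _ x y
  | succ n ih =>
    obtain ⟨a, b, rfl⟩ := pair_surj x
    obtain ⟨c, d, rfl⟩ := pair_surj y
    let : StarAddMonoid (CayleyDickson n) :=
      { star_involutive := star_star', star_add := star_add' }
    simp only [pair_mul, star_pair, ih, star_sub, star_neg, star_star, mul_neg, neg_mul, neg_neg,
      neg_add_rev]

instance instStarRing (n : ℕ) : StarRing (CayleyDickson n) where
  star_involutive := star_star'
  star_mul := star_mul'
  star_add := star_add'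

theorem add_star (x : CayleyDickson n) : x + star x = (2 * re n x) • (1 : CayleyDickson n) := by
  rw [mul_smul, ← rePart_eq, rePart, smul_smul, mul_one_div_cancel two_ne_zero, one_smul]

theorem star_eq (x : CayleyDickson n) : star x = (2 * re n x) • (1 : CayleyDickson n) - x :=
  eq_sub_of_add_eq' (add_star x)

theorem mul_star_add_mul_star (x y : CayleyDickson n) :
    x * star y + y * star x = (2 * inner ℝ x y) • (1 : CayleyDickson n) := by
  rw [inner_def, ← add_star, star_mul, star_star]

theorem mul_star_self (x : CayleyDickson n) :
    x * star x = ‖x‖ ^ 2 • (1 : CayleyDickson n) := by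
  have h := mul_star_add_mul_star x x
  rw [← two_smul ℝ, mul_smul, real_inner_self_eq_norm_sq] at h
  exact smul_right_injective _ (two_ne_zero (α := ℝ)) h

theorem star_mul_self (x : CayleyDickson n) :
    star x * x = ‖x‖ ^ 2 • (1 : CayleyDickson n) := by
  rw [← mul_star_self, star_eq]
  simp only [mul_sub, sub_mul, smul_mul_assoc, mul_smul_comm, one_mul, mul_one]

theorem isImaginary_iff_star_eq_neg {x : CayleyDickson n} : x.IsImaginary ↔ star x = -x := by
  rw [IsImaginary, rePart, smul_eq_zero_iff_right (by norm_num), add_comm, add_eq_zero_iff_eq_neg]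

theorem isImaginary_of_inner_one_eq_zero {x : CayleyDickson n} (hx : inner ℝ 1 x = 0) :
    x.IsImaginary := by
  rw [real_inner_comm, inner_def, star_one, mul_one] at hx
  rw [IsImaginary, rePart_eq, hx, zero_smul]

theorem norm_pair_sq (a b : CayleyDickson n) : ‖pair a b‖ ^ 2 = ‖a‖ ^ 2 + ‖b‖ ^ 2 := by
  simp only [← real_inner_self_eq_norm_sq, inner_pair]

end Star

section Imaginary

variable {a b : CayleyDickson n}

theorem IsImaginary.mul_add_mul (ha : a.IsImaginary) (hb : b.IsImaginary) :
    a * b + b * a = -((2 * inner ℝ a b) • (1 : CayleyDickson n)) := by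
  rw [← mul_star_add_mul_star, isImaginary_iff_star_eq_neg.1 ha, isImaginary_iff_star_eq_neg.1 hb,
    mul_neg, mul_neg, neg_add, neg_neg, neg_neg]

theorem IsImaginary.mul_self (ha : a.IsImaginary) :
    a * a = -(‖a‖ ^ 2 • (1 : CayleyDickson n)) := by
  rw [← mul_star_self, isImaginary_iff_star_eq_neg.1 ha, mul_neg, neg_neg]

theorem IsImaginary.lie (ha : a.IsImaginary) (hb : b.IsImaginary) : IsImaginary ⁅a, b⁆ := by
  rw [isImaginary_iff_star_eq_neg, Ring.lie_def, star_sub, star_mul, star_mul,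
    isImaginary_iff_star_eq_neg.1 ha, isImaginary_iff_star_eq_neg.1 hb, neg_mul_neg, neg_mul_neg,
    neg_sub]

end Imaginary

section Doubling

theorem mul_comm_succ (hstar : ∀ x : CayleyDickson n, star x = x) (x y : CayleyDickson (n + 1)) :
    x * y = y * x := by
  obtain ⟨a, b, rfl⟩ := pair_surj x
  obtain ⟨c, d, rfl⟩ := pair_surj y
  have hcomm (u v : CayleyDickson n) : u * v = v * u := by
    rw [← hstar (u * v), star_mul, hstar, hstar]
  rw [pair_mul, pair_mul, hstar, hstar, hstar, hstar, hcomm c, hcomm b d,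
    add_comm (d * a)]

theorem mul_assoc_succ (hcomm : ∀ x y : CayleyDickson n, x * y = y * x)
    (hassoc : ∀ x y z : CayleyDickson n, x * y * z = x * (y * z)) (x y z : CayleyDickson (n + 1)) :
    x * y * z = x * (y * z) := by
  obtain ⟨a, b, rfl⟩ := pair_surj x
  obtain ⟨c, d, rfl⟩ := pair_surj y
  obtain ⟨e, f, rfl⟩ := pair_surj z
  let : CommRing (CayleyDickson n) :=
    { instNonAssocRing n with mul_comm := hcomm, mul_assoc := hassoc }
  simp only [pair_mul, star_add, star_sub, star_mul, star_star]
  congr 1 <;> ring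

theorem star_mul_mul_succ (hassoc : ∀ x y z : CayleyDickson n, x * y * z = x * (y * z))
    (x y : CayleyDickson (n + 1)) : star x * (x * y) = ‖x‖ ^ 2 • y := by
  obtain ⟨a, b, rfl⟩ := pair_surj x
  obtain ⟨c, d, rfl⟩ := pair_surj y
  have star_mul_mul (u v : CayleyDickson n) : star u * (u * v) = ‖u‖ ^ 2 • v := by
    rw [← hassoc, star_mul_self, smul_mul_assoc, one_mul]
  have mul_star_mul (u v : CayleyDickson n) : u * (star u * v) = ‖u‖ ^ 2 • v := by
    rw [← hassoc, mul_star_self, smul_mul_assoc, one_mul]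
  simp only [star_pair, pair_mul, star_add, star_sub, star_mul, star_star, mul_sub, add_mul,
    neg_mul, mul_neg, hassoc, star_mul_mul, mul_star_mul, star_mul_self, mul_star_self,
    mul_smul_comm, mul_one, norm_pair_sq, smul_pair, add_smul]
  congr 1 <;> abel

theorem isAlternative_of_star_mul_mul
    (h : ∀ x y : CayleyDickson n, star x * (x * y) = ‖x‖ ^ 2 • y) :
    IsAlternative (CayleyDickson n) := by
  have mul_self_mul (x y : CayleyDickson n) : x * x * y = x * (x * y) := by
    have hxy : star x * x * y = star x * (x * y) := by
      rw [h, star_mul_self, smul_mul_assoc, one_mul]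
    simp only [star_eq, sub_mul, smul_mul_assoc, one_mul] at hxy
    exact sub_right_injective hxy
  refine ⟨mul_self_mul, fun x y => star_injective ?_⟩
  rw [star_mul, star_mul, star_mul, star_mul, mul_self_mul]

instance : IsAlternative (CayleyDickson 3) :=
  isAlternative_of_star_mul_mul (star_mul_mul_succ (mul_assoc_succ (mul_comm_succ fun _ => rfl)
    (mul_assoc_succ (fun x y => @mul_comm ℝ _ x y) fun x y z => @mul_assoc ℝ _ x y z)))

end Doubling

section Pair

open Module

variable (n) in
/-- The identification `(a, b) ↦ pair a b` of `A n × A n` with `A (n + 1)`, as a linear map. -/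
def pairEquiv : (CayleyDickson n × CayleyDickson n) ≃ₗ[ℝ] CayleyDickson (n + 1) where
  toFun z := pair z.1 z.2
  invFun x := (x.1, x.2)
  map_add' _ _ := rfl
  map_smul' _ _ := rfl

theorem pairEquiv_apply (z : CayleyDickson n × CayleyDickson n) :
    pairEquiv n z = pair z.1 z.2 := rfl

instance instFiniteDimensional (n : ℕ) : FiniteDimensional ℝ (CayleyDickson n) := by
  induction n with
  | zero => exact inferInstanceAs (FiniteDimensional ℝ ℝ)
  | succ n ih => exact Module.Finite.equiv (pairEquiv n)

theorem finrank_eq (n : ℕ) : finrank ℝ (CayleyDickson n) = 2 ^ n := by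
  induction n with
  | zero => exact finrank_self ℝ
  | succ n ih => rw [← (pairEquiv n).finrank_eq, finrank_prod, ih, pow_succ, mul_two]

theorem associator_star_mid (a b x : CayleyDickson n) :
    associator a (star x) b = -associator a x b := by
  simp only [associator_apply, star_eq, mul_sub, sub_mul, mul_smul_comm, smul_mul_assoc, mul_one,
    one_mul]
  abel

variable [IsAlternative (CayleyDickson n)] {a b : CayleyDickson n}

theorem IsImaginary.mul_mul_self_left (ha : a.IsImaginary) (x : CayleyDickson n) :
    a * (a * x) = -(‖a‖ ^ 2 • x) := by
  rw [← IsAlternative.mul_self_mul, ha.mul_self, neg_mul, smul_one_mul]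

theorem IsImaginary.mul_mul_self_right (ha : a.IsImaginary) (x : CayleyDickson n) :
    x * a * a = -(‖a‖ ^ 2 • x) := by
  rw [IsAlternative.mul_mul_self, ha.mul_self, mul_neg, mul_smul_one]

theorem star_pair_mul_pair_mul (ha : a.IsImaginary) (hb : b.IsImaginary)
    (z : CayleyDickson n × CayleyDickson n) :
    star (pair a b) * (pair a b * pairEquiv n z) =
      pairEquiv n (‖pair a b‖ ^ 2 • z + skewBlock (associatorLeft ℝ a b) z) := by
  obtain ⟨x, y⟩ := z
  have hfst : associator a (star y) b = associator a b y := by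
    rw [associator_star_mid, associator_swap_right, neg_neg]
  have hsnd : associator b (star x) a = -associator a b x := by
    rw [associator_star_mid, ← associator_rotate]
  simp only [pairEquiv_apply, skewBlock_apply, norm_pair_sq, associatorLeft_apply, ← hfst,
    ← neg_eq_iff_eq_neg.2 hsnd, associator_apply, star_pair, pair_mul, star_add, star_sub, star_mul,
    star_star, isImaginary_iff_star_eq_neg.1 ha, isImaginary_iff_star_eq_neg.1 hb, neg_mul,
    mul_neg, mul_sub, add_mul, ha.mul_mul_self_left, ha.mul_mul_self_right,
    hb.mul_mul_self_left, hb.mul_mul_self_right, Prod.smul_mk, Prod.mk_add_mk, add_smul]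
  congr 1 <;> abel

theorem M_pair_pairEquiv (ha : a.IsImaginary) (hb : b.IsImaginary) (h0 : pair a b ≠ 0)
    (z : CayleyDickson n × CayleyDickson n) :
    (pair a b).M (pairEquiv n z) =
      pairEquiv n (z + (1 / ‖pair a b‖ ^ 2) • skewBlock (associatorLeft ℝ a b) z) := by
  have hN : ‖pair a b‖ ^ 2 ≠ 0 := pow_ne_zero 2 (norm_ne_zero_iff.2 h0)
  rw [M, LinearMap.smul_apply, LinearMap.comp_apply, LinearMap.mulLeft_apply,
    LinearMap.mulLeft_apply, star_pair_mul_pair_mul ha hb, ← map_smul, smul_add, smul_smul,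
    one_div_mul_cancel hN, one_smul]

theorem eigenspace_M_pair (ha : a.IsImaginary) (hb : b.IsImaginary) (h0 : pair a b ≠ 0)
    (c : ℝ) :
    (pair a b).M.eigenspace (1 + c / ‖pair a b‖ ^ 2) =
      ((skewBlock (associatorLeft ℝ a b)).eigenspace c).map (pairEquiv n).toLinearMap := by
  have hN : 1 / ‖pair a b‖ ^ 2 ≠ 0 := one_div_ne_zero (pow_ne_zero 2 (norm_ne_zero_iff.2 h0))
  ext w
  obtain ⟨z, rfl⟩ := (pairEquiv n).surjective w
  rw [End.mem_eigenspace_iff, M_pair_pairEquiv ha hb h0,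
    ← map_smul (pairEquiv n), (pairEquiv n).injective.eq_iff, add_smul, one_smul, add_right_inj,
    ← one_div_mul_eq_div _ c, mul_smul _ c, (smul_right_injective _ hN).eq_iff,
    Submodule.mem_map_equiv, LinearEquiv.symm_apply_apply, End.mem_eigenspace_iff]

theorem finrank_eigenspace_M_pair (ha : a.IsImaginary) (hb : b.IsImaginary) (h0 : pair a b ≠ 0)
    (c : ℝ) :
    finrank ℝ ((pair a b).M.eigenspace (1 + c / ‖pair a b‖ ^ 2)) =
      finrank ℝ ((skewBlock (associatorLeft ℝ a b)).eigenspace c) := by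
  rw [eigenspace_M_pair ha hb h0]
  exact LinearEquiv.finrank_map_eq _ _

theorem hasEigenvalue_M_pair_iff (ha : a.IsImaginary) (hb : b.IsImaginary) (h0 : pair a b ≠ 0)
    {c : ℝ} :
    (pair a b).M.HasEigenvalue (1 + c / ‖pair a b‖ ^ 2) ↔
      (skewBlock (associatorLeft ℝ a b)).HasEigenvalue c := by
  rw [hasEigenvalue_iff_finrank_ne_zero, hasEigenvalue_iff_finrank_ne_zero,
    finrank_eigenspace_M_pair ha hb h0]

theorem finrank_eigenspace_M_pair_one (ha : a.IsImaginary) (hb : b.IsImaginary)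
    (h0 : pair a b ≠ 0) :
    finrank ℝ ((pair a b).M.eigenspace 1) =
      2 * finrank ℝ (LinearMap.ker (associatorLeft ℝ a b)) := by
  have h := finrank_eigenspace_M_pair ha hb h0 0
  rwa [zero_div, add_zero, End.eigenspace_zero, ker_skewBlock, finrank_submodule_prod,
    ← two_mul] at h

theorem finrank_ker_add_finrank_eigenspace_M_pair_one_add (ha : a.IsImaginary)
    (hb : b.IsImaginary) (h0 : pair a b ≠ 0) {s : ℝ} (hs : s ≠ 0)
    (hT : associatorLeft ℝ a b ^ 3 = -(s ^ 2 • associatorLeft ℝ a b)) :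
    finrank ℝ (LinearMap.ker (associatorLeft ℝ a b)) +
      finrank ℝ ((pair a b).M.eigenspace (1 + s / ‖pair a b‖ ^ 2)) = 2 ^ n := by
  rw [finrank_eigenspace_M_pair ha hb h0, finrank_ker_add_finrank_eigenspace_skewBlock hs hT,
    finrank_eq]

theorem finrank_ker_add_finrank_eigenspace_M_pair_one_sub (ha : a.IsImaginary)
    (hb : b.IsImaginary) (h0 : pair a b ≠ 0) {s : ℝ} (hs : s ≠ 0)
    (hT : associatorLeft ℝ a b ^ 3 = -(s ^ 2 • associatorLeft ℝ a b)) :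
    finrank ℝ (LinearMap.ker (associatorLeft ℝ a b)) +
      finrank ℝ ((pair a b).M.eigenspace (1 - s / ‖pair a b‖ ^ 2)) = 2 ^ n := by
  rw [← neg_sq] at hT
  rw [sub_eq_add_neg, ← neg_div]
  exact finrank_ker_add_finrank_eigenspace_M_pair_one_add ha hb h0 (neg_ne_zero.2 hs) hT

theorem eigenvalue_M_pair_cases (ha : a.IsImaginary) (hb : b.IsImaginary) (h0 : pair a b ≠ 0)
    {s μ : ℝ} (hT : associatorLeft ℝ a b ^ 3 = -(s ^ 2 • associatorLeft ℝ a b))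
    (hμ : (pair a b).M.HasEigenvalue μ) :
    μ = 1 ∨ μ = 1 + s / ‖pair a b‖ ^ 2 ∨ μ = 1 - s / ‖pair a b‖ ^ 2 := by
  have hN : ‖pair a b‖ ^ 2 ≠ 0 := pow_ne_zero 2 (norm_ne_zero_iff.2 h0)
  obtain ⟨c, rfl⟩ : ∃ c, μ = 1 + c / ‖pair a b‖ ^ 2 :=
    ⟨(μ - 1) * ‖pair a b‖ ^ 2, by rw [mul_div_cancel_right₀ _ hN, add_sub_cancel]⟩
  rw [hasEigenvalue_M_pair_iff ha hb h0] at hμ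
  rcases eq_zero_or_eq_or_eq_neg_of_pow_three_eq (skewBlock_pow_three hT) hμ with rfl | rfl | rfl
  · left; rw [zero_div, add_zero]
  · right; left; rfl
  · right; right; rw [neg_div, sub_eq_add_neg]

end Pair

section Associator

open Module LinearMap

variable [IsAlternative (CayleyDickson n)] {a b : CayleyDickson n}

theorem mulLeft_pow_two_of_isImaginary (ha : a.IsImaginary) :
    mulLeft ℝ a ^ 2 = -(‖a‖ ^ 2 • 1) := by
  rw [mulLeft_pow_two, ha.mul_self, mulLeft_neg_smul_one]

theorem lie_mulLeft_pow_two (ha : a.IsImaginary) (hb : b.IsImaginary) :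
    ⁅mulLeft ℝ a, mulLeft ℝ b⁆ ^ 2 = -((4 * (‖a‖ ^ 2 * ‖b‖ ^ 2 - inner ℝ a b ^ 2)) • 1) := by
  refine lie_pow_two_of_anticommutator (mulLeft_pow_two_of_isImaginary ha)
    (mulLeft_pow_two_of_isImaginary hb) ?_
  rw [mulLeft_mul_add_mulLeft_mul, ha.mul_add_mul hb, mulLeft_neg_smul_one]

theorem lie_mul_lie (ha : a.IsImaginary) (hb : b.IsImaginary) :
    ⁅a, b⁆ * ⁅a, b⁆ = -((4 * (‖a‖ ^ 2 * ‖b‖ ^ 2 - inner ℝ a b ^ 2)) • (1 : CayleyDickson n)) := by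
  have hT := LinearMap.congr_fun (two_smul_associatorLeft (F := ℝ) a b) ⁅a, b⁆
  have h1 : ⁅mulLeft ℝ a, mulLeft ℝ b⁆ 1 = ⁅a, b⁆ := by
    simp only [Ring.lie_def, LinearMap.sub_apply, Module.End.mul_apply, mulLeft_apply, mul_one]
  rw [LinearMap.smul_apply, associatorLeft_apply, associator_lie_right, smul_zero,
    LinearMap.sub_apply, mulLeft_apply, eq_comm, sub_eq_zero] at hT
  have hsq := LinearMap.congr_fun (lie_mulLeft_pow_two ha hb) (1 : CayleyDickson n)
  rw [sq, Module.End.mul_apply, h1] at hsq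
  exact hT.trans hsq

theorem IsImaginary.mul_lie_add_lie_mul (ha : a.IsImaginary) (b : CayleyDickson n) :
    a * ⁅a, b⁆ + ⁅a, b⁆ * a = 0 := by
  rw [_root_.mul_lie_add_lie_mul, ha.mul_self, Ring.lie_def, neg_mul, mul_neg, smul_one_mul,
    mul_smul_one, sub_self]

theorem mulLeft_lie_pow_two (ha : a.IsImaginary) (hb : b.IsImaginary) :
    mulLeft ℝ ⁅a, b⁆ ^ 2 = -((4 * (‖a‖ ^ 2 * ‖b‖ ^ 2 - inner ℝ a b ^ 2)) • 1) := by
  rw [mulLeft_pow_two, lie_mul_lie ha hb, mulLeft_neg_smul_one]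

theorem commute_mulLeft_lie (ha : a.IsImaginary) (hb : b.IsImaginary) :
    Commute (mulLeft ℝ ⁅a, b⁆) ⁅mulLeft ℝ a, mulLeft ℝ b⁆ := by
  have hwa : ⁅a, b⁆ * a + a * ⁅a, b⁆ = 0 := by rw [add_comm, ha.mul_lie_add_lie_mul]
  have hwb : ⁅a, b⁆ * b + b * ⁅a, b⁆ = 0 := by
    have hskew : ⁅a, b⁆ = -⁅b, a⁆ := by rw [Ring.lie_def, Ring.lie_def, neg_sub]
    rw [hskew, neg_mul, mul_neg, ← neg_add, add_comm, hb.mul_lie_add_lie_mul, neg_zero]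
  exact commute_lie_of_semiconjBy_neg (semiconjBy_mulLeft_neg hwa) (semiconjBy_mulLeft_neg hwb)

theorem associatorLeft_pow_three (ha : a.IsImaginary) (hb : b.IsImaginary) :
    associatorLeft ℝ a b ^ 3 =
      -((4 * (‖a‖ ^ 2 * ‖b‖ ^ 2 - inner ℝ a b ^ 2)) • associatorLeft ℝ a b) := by
  have h := sub_pow_three_of_commute (mulLeft_lie_pow_two ha hb) (lie_mulLeft_pow_two ha hb)
    (commute_mulLeft_lie ha hb)
  rw [← two_smul_associatorLeft, smul_pow] at h
  linear_combination (norm := module) (1 / 8 : ℝ) • h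

theorem two_mul_finrank_ker_associatorLeft (ha : a.IsImaginary) (hb : b.IsImaginary)
    (hab : ‖a‖ ^ 2 * ‖b‖ ^ 2 - inner ℝ a b ^ 2 ≠ 0) {c : CayleyDickson n} (hc : c.IsImaginary)
    (hc0 : c ≠ 0) (hca : inner ℝ a c = 0) (hcb : inner ℝ b c = 0) (hcw : inner ℝ ⁅a, b⁆ c = 0) :
    2 * finrank ℝ (ker (associatorLeft ℝ a b)) = finrank ℝ (CayleyDickson n) := by
  have hanti {u : CayleyDickson n} (hu : u.IsImaginary) (h : inner ℝ u c = 0) :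
      SemiconjBy (mulLeft ℝ c) (mulLeft ℝ u) (-mulLeft ℝ u) :=
    semiconjBy_mulLeft_neg (by rw [add_comm, hu.mul_add_mul hc, h, mul_zero, zero_smul, neg_zero])
  have hinj : Function.Injective (mulLeft ℝ c) := injective_of_pow_two_eq_neg_smul
    (pow_ne_zero 2 (norm_ne_zero_iff.2 hc0)) (mulLeft_pow_two_of_isImaginary hc)
  rw [← ker_smul _ (2 : ℝ) two_ne_zero, two_smul_associatorLeft]
  exact two_mul_finrank_ker_sub_of_commute (mul_ne_zero four_ne_zero hab)
    (mulLeft_lie_pow_two ha hb) (lie_mulLeft_pow_two ha hb) (commute_mulLeft_lie ha hb) hinj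
    (hanti (ha.lie hb) hcw) (commute_lie_of_semiconjBy_neg (hanti ha hca) (hanti hb hcb))

theorem finrank_ker_associatorLeft {a b : CayleyDickson 3} (ha : a.IsImaginary)
    (hb : b.IsImaginary) (hab : ‖a‖ ^ 2 * ‖b‖ ^ 2 - inner ℝ a b ^ 2 ≠ 0) :
    finrank ℝ (ker (associatorLeft ℝ a b)) = 4 := by
  obtain ⟨c, hc0, hc⟩ := exists_ne_zero_forall_inner_eq_zero ![1, a, b, ⁅a, b⁆]
    (by rw [Fintype.card_fin, finrank_eq]; norm_num)
  have h := two_mul_finrank_ker_associatorLeft ha hb hab (isImaginary_of_inner_one_eq_zero (hc 0))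
    hc0 (hc 1) (hc 2) (hc 3)
  rw [finrank_eq] at h
  omega

end Associator

end CayleyDickson

theorem mainTheorem6 (a b : CayleyDickson 3)
    (ha : a.IsImaginary) (hb : b.IsImaginary) (hab : LinearIndependent ℝ ![a, b])
    (θ δ : ℝ) (hθ : θ = InnerProductGeometry.angle a b)
    (hδ : δ = 2 * ‖a‖ * ‖b‖ * Real.sin θ / (‖a‖ ^ 2 + ‖b‖ ^ 2)) :
    (∀ μ : ℝ, (CayleyDickson.pair a b).M.HasEigenvalue μ ↔ μ = 1 ∨ μ = 1 + δ ∨ μ = 1 - δ) ∧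
    Module.finrank ℝ ((CayleyDickson.pair a b).M.eigenspace 1) = 8 ∧
    Module.finrank ℝ ((CayleyDickson.pair a b).M.eigenspace (1 + δ)) = 4 ∧
    Module.finrank ℝ ((CayleyDickson.pair a b).M.eigenspace (1 - δ)) = 4 := by
  rw [← CayleyDickson.norm_pair_sq, hθ] at hδ
  set s := 2 * ‖a‖ * ‖b‖ * Real.sin (InnerProductGeometry.angle a b)
  have hs : s ≠ 0 := two_mul_norm_mul_norm_mul_sin_angle_ne_zero hab
  have hsq : s ^ 2 = 4 * (‖a‖ ^ 2 * ‖b‖ ^ 2 - inner ℝ a b ^ 2) :=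
    two_mul_norm_mul_norm_mul_sin_angle_sq a b
  have hv : CayleyDickson.pair a b ≠ 0 := fun h => hab.ne_zero 0 (congrArg Prod.fst h)
  have hT : associatorLeft ℝ a b ^ 3 = -(s ^ 2 • associatorLeft ℝ a b) := by
    rw [hsq, CayleyDickson.associatorLeft_pow_three ha hb]
  have hker : Module.finrank ℝ (LinearMap.ker (associatorLeft ℝ a b)) = 4 :=
    CayleyDickson.finrank_ker_associatorLeft ha hb
      (right_ne_zero_of_mul (hsq ▸ pow_ne_zero 2 hs))
  have hone := CayleyDickson.finrank_eigenspace_M_pair_one ha hb hv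
  have hadd := CayleyDickson.finrank_ker_add_finrank_eigenspace_M_pair_one_add ha hb hv hs hT
  have hsub := CayleyDickson.finrank_ker_add_finrank_eigenspace_M_pair_one_sub ha hb hv hs hT
  rw [← hδ] at hadd hsub
  refine ⟨fun μ => ⟨fun hμ => hδ ▸ CayleyDickson.eigenvalue_M_pair_cases ha hb hv hT hμ, ?_⟩,
    by omega, by omega, by omega⟩
  rintro (rfl | rfl | rfl) <;> rw [hasEigenvalue_iff_finrank_ne_zero] <;> omega
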